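/- Let $R$ be an integral domain which is not a field, with quotient field $L$. For $R$-submodules $A,B$ of $L$ put $(A:B)=\{x\in L : xB\subseteq A\}$, and for a nonzero ideal $I$ of $R$ put $I^{-1}=(R:I)$ and $I_v=(R:I^{-1})$. A nonzero ideal $I$ is divisorial (a $v$-ideal) if $I=I_v$, and strongly divisorial if $I=II^{-1}=I_v$; let $SD(R)$ be the set of all nonzero strongly divisorial ideals of $R$. An overring of $R$ is a ring $T$ with $R\subseteq T\subseteq L$; it is $t$-linked over $R$ if $(T:JT)=T$ for every finitely generated ideal $J$ of $R$ with $J^{-1}=R$. Let $\mathcal O_t(R)$ be the set of $t$-linked overrings of $R$, and let $$\phi_R: SD(R)\longrightarrow \mathcal O_t(R)\setminus\{L\},\qquad I\mapsto I^{-1}=(I:I),$$ which is a well-defined map. The domain $R$ is Mori if it satisfies the ascending chain condition on (integral) divisorial ideals, and conducive if $(R:T)\neq(0)$ for each overring $T\subsetneq L$ of $R$. Corollary. Let $R$ be a Mori domain that is not a field. If $\phi_R$ is surjective, then $R$ is a one-dimensional conducive local domain (local meaning that $R$ has exactly one maximal ideal), and either (i) $R$ is a discrete valuation ring, or (ii)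 the maximal ideal $M$ of $R$ is strongly divisorial and each overring $T\supsetneq R$ of $R$ contains $M^{-1}$. -/

import Mathlib

open scoped nonZeroDivisors

namespace TLinked

section Definitions

variable {R : Type*} [CommRing R] (K : Type*) [Field K] [Algebra R K]

/-- An ideal `I` of `R`, seen as an `R`-submodule of the field `K`. -/
abbrev toSub (I : Ideal R) : Submodule R K := IsLocalization.coeSubmodule K I

/-- `I⁻¹ = (R : I) = {x ∈ K | x I ⊆ R}`, as an `R`-submodule of `K`. In `Submodule R K`, the
quotient `A / B` is the colon module `(A : B) = {x ∈ K | x B ⊆ A}` and `1` is the image of `R`. -/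
abbrev idealInv (I : Ideal R) : Submodule R K := 1 / toSub K I

/-- A nonzero ideal `I` of `R` is divisorial (a `v`-ideal) if `I = I_v = (I⁻¹)⁻¹`. -/
def IsDivisorial (I : Ideal R) : Prop :=
  I ≠ ⊥ ∧ 1 / idealInv K I = toSub K I

/-- A nonzero ideal `I` of `R` is strong (a trace ideal) if `I = I I⁻¹`. -/
def IsStrong (I : Ideal R) : Prop :=
  I ≠ ⊥ ∧ toSub K I * idealInv K I = toSub K I

/-- A nonzero ideal is strongly divisorial if it is both strong and divisorial. -/
def IsStronglyDivisorial (I : Ideal R) : Prop :=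
  IsStrong K I ∧ IsDivisorial K I

variable (R) in
/-- `R` is a Mori domain: the ascending chain condition on (integral) `v`-ideals. -/
def IsMori : Prop := WellFoundedGT {I : Ideal R // IsDivisorial K I}

variable (R) in
/-- `R` is conducive: `(R : T) ≠ 0` for each overring `T` of `R` with `T ≠ K`.
The overrings of `R` are the `R`-subalgebras of the quotient field `K`. -/
def IsConducive : Prop :=
  ∀ T : Subalgebra R K, T ≠ ⊤ → (1 : Submodule R K) / Subalgebra.toSubmodule T ≠ ⊥

variable {K} in
/-- The overring `T` is `t`-linked over `R`: for each finitely generated ideal `J` of `R`,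
`J⁻¹ = R` implies `(T : JT) = T`. -/
def IsTLinked (T : Subalgebra R K) : Prop :=
  ∀ J : Ideal R, J.FG → idealInv K J = 1 →
    Subalgebra.toSubmodule T / (toSub K J * Subalgebra.toSubmodule T) = Subalgebra.toSubmodule T

variable (R) in
/-- The set `SD(R)` of all (nonzero) strongly divisorial ideals of `R`. -/
def SD : Set (Ideal R) := {I | IsStronglyDivisorial K I}

variable (R) in
/-- The set `O_t(R) ∖ {K}` of all `t`-linked overrings of `R` other than the quotient field. -/
def properTLinked : Set (Subalgebra R K) := {T | IsTLinked T ∧ T ≠ ⊤}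

/-- For a strong ideal `I`, the module `I⁻¹` is an overring of `R`. -/
def invOverring (I : Ideal R) (hI : IsStrong K I) : Subalgebra R K where
  carrier := idealInv K I
  mul_mem' := by
    intro x y hx hy
    refine Submodule.mem_div_iff_forall_mul_mem.2 fun a ha => ?_
    have h1 : a * y ∈ toSub K I := hI.2 ▸ Submodule.mul_mem_mul ha hy
    have h2 := Submodule.mem_div_iff_forall_mul_mem.1 hx _ h1
    rwa [mul_comm a y, ← mul_assoc] at h2
  add_mem' := fun hx hy => add_mem hx hy
  algebraMap_mem' := by
    intro r
    refine Submodule.mem_div_iff_forall_mul_mem.2 fun a ha => ?_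
    obtain ⟨b, -, rfl⟩ := (IsLocalization.mem_coeSubmodule K I).1 ha
    exact Submodule.mem_one.2 ⟨r * b, map_mul _ _ _⟩

theorem toSubmodule_invOverring (I : Ideal R) (hI : IsStrong K I) :
    Subalgebra.toSubmodule (invOverring K I hI) = idealInv K I :=
  rfl

theorem isTLinked_invOverring (I : Ideal R) (hI : IsStrong K I) :
    IsTLinked (invOverring K I hI) := by
  intro J _ hJ
  apply le_antisymm
  · intro x hx
    rw [toSubmodule_invOverring]
    refine Submodule.mem_div_iff_forall_mul_mem.2 fun a ha => ?_
    rw [← hJ]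
    refine Submodule.mem_div_iff_forall_mul_mem.2 fun b hb => ?_
    have h1 : b * 1 ∈ toSub K J * Subalgebra.toSubmodule (invOverring K I hI) :=
      Submodule.mul_mem_mul hb (one_mem (invOverring K I hI))
    have h2 : x * (b * 1) ∈ idealInv K I := Submodule.mem_div_iff_forall_mul_mem.1 hx _ h1
    have h3 := Submodule.mem_div_iff_forall_mul_mem.1 h2 a ha
    have h4 : x * (b * 1) * a = x * a * b := by ring
    rwa [h4] at h3
  · rw [Submodule.le_div_iff_mul_le]
    refine Submodule.mul_le.2 fun x hx y hy => ?_
    refine Submodule.mul_induction_on hy (fun b hb t ht => ?_) (fun u v hu hv => ?_)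
    · obtain ⟨c, -, rfl⟩ := (IsLocalization.mem_coeSubmodule K J).1 hb
      exact mul_mem (S := Subalgebra R K) hx
        (mul_mem ((invOverring K I hI).algebraMap_mem c) ht)
    · rw [mul_add]
      exact add_mem hu hv

theorem invOverring_ne_top [IsFractionRing R K] (hR : ¬ IsField R) (I : Ideal R)
    (hI : IsStrong K I) : invOverring K I hI ≠ ⊤ := by
  intro h
  obtain ⟨a, ha, ha0⟩ := Submodule.exists_mem_ne_zero_of_ne_bot hI.1
  have hinj := IsFractionRing.injective R K
  have ha0' : algebraMap R K a ≠ 0 := fun h0 => ha0 (hinj (by simpa using h0))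
  have hsurj : Function.Surjective (algebraMap R K) := by
    intro x
    have h1 : x * (algebraMap R K a)⁻¹ ∈ invOverring K I hI := h ▸ Algebra.mem_top
    have h2 := Submodule.mem_div_iff_forall_mul_mem.1
      (show x * (algebraMap R K a)⁻¹ ∈ idealInv K I from h1) (algebraMap R K a)
      ((IsLocalization.mem_coeSubmodule K I).2 ⟨a, ha, rfl⟩)
    rw [inv_mul_cancel_right₀ ha0'] at h2
    exact Submodule.mem_one.1 h2
  exact hR ((RingEquiv.ofBijective (algebraMap R K) ⟨hinj, hsurj⟩).toMulEquiv.isField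
    (Field.toIsField K))

/-- The map `φ_R : SD(R) → O_t(R) ∖ {K}`, `I ↦ I⁻¹`, for a domain `R` that is not a field. -/
def phi [IsFractionRing R K] (hR : ¬ IsField R) : SD R K → properTLinked R K :=
  fun I => ⟨invOverring K I.1 I.2.1, isTLinked_invOverring K I.1 I.2.1,
    invOverring_ne_top K hR I.1 I.2.1⟩

end Definitions

end TLinked

namespace TLinked

/-! ### Divisorial ideals and consequences of the Mori condition. -/

section Divisorial

variable {R : Type*} [CommRing R] {K : Type*} [Field K] [Algebra R K]

/-! In a Mori domain a maximal proper divisorial ideal `P` exists and is prime. No `J` with `J⁻¹ =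
R` lies in `P`, so `R_P` is `t`-linked and surjectivity makes it some `I⁻¹`. A nonzero `a ∈ I` is
then divisible by all powers of each `s ∉ P`, and the ascending chain condition on principal ideals
forces `s` to be a unit (`isUnit_of_notMem`). Hence `R` is local with divisorial maximal ideal `M =
P`. Now `J⁻¹ = R` only for `J = R`, so every overring is `t`-linked. The same argument applied to
any nonzero prime gives dimension one. Each overring `T ≠ K` is `I⁻¹` with `I` divisorial, so `(R :
T) = I ≠ 0`, and `T ≠ R` gives `I ≤ M`, hence `M⁻¹ ≤ T`. Finally `M M⁻¹` is `M` or `R`; in the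
latter case `M` is principal and `R` is a discrete valuation ring. -/

theorem algebraMap_mem_toSub [IsFractionRing R K] {I : Ideal R} {a : R} :
    algebraMap R K a ∈ toSub K I ↔ a ∈ I := by
  refine ⟨fun h => ?_, fun h => (IsLocalization.mem_coeSubmodule K I).2 ⟨a, h, rfl⟩⟩
  obtain ⟨b, hb, hba⟩ := (IsLocalization.mem_coeSubmodule K I).1 h
  exact IsFractionRing.injective R K hba ▸ hb

theorem mem_idealInv {I : Ideal R} {x : K} :
    x ∈ idealInv K I ↔ ∀ a ∈ I, x * algebraMap R K a ∈ (1 : Submodule R K) := by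
  refine ⟨fun h a ha => h _ ((IsLocalization.mem_coeSubmodule K I).2 ⟨a, ha, rfl⟩),
    fun h y hy => ?_⟩
  obtain ⟨a, ha, rfl⟩ := (IsLocalization.mem_coeSubmodule K I).1 hy
  exact h a ha

theorem one_mem_idealInv (I : Ideal R) : (1 : K) ∈ idealInv K I :=
  mem_idealInv.2 fun a _ => Submodule.mem_one.2 ⟨a, (one_mul _).symm⟩

theorem idealInv_anti {I J : Ideal R} (h : I ≤ J) : idealInv K J ≤ idealInv K I :=
  fun _ hx => mem_idealInv.2 fun a ha => mem_idealInv.1 hx a (h ha)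

theorem idealInv_top : idealInv K (⊤ : Ideal R) = 1 := by
  refine le_antisymm (fun x hx => ?_) (Submodule.one_le.2 (one_mem_idealInv _))
  simpa using mem_idealInv.1 hx 1 trivial

theorem isDivisorial_iff [IsFractionRing R K] {I : Ideal R} :
    IsDivisorial K I ↔ I ≠ ⊥ ∧ ∀ a : R,
      (∀ y ∈ idealInv K I, algebraMap R K a * y ∈ (1 : Submodule R K)) → a ∈ I := by
  refine ⟨fun h => ⟨h.1, fun a ha => ?_⟩, fun h => ⟨h.1, le_antisymm (fun x hx => ?_) ?_⟩⟩
  · rw [← algebraMap_mem_toSub (K := K), ← h.2]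
    exact ha
  · obtain ⟨a, rfl⟩ := Submodule.mem_one.1 (by simpa using hx 1 (one_mem_idealInv I))
    exact algebraMap_mem_toSub.2 (h.2 a hx)
  · intro x hx y hy
    rw [mul_comm]
    exact hy x hx

theorem IsDivisorial.eq_top_of_le [IsFractionRing R K] {I J : Ideal R} (hI : IsDivisorial K I)
    (hJI : J ≤ I) (hJ : idealInv K J = 1) : I = ⊤ := by
  refine (Ideal.eq_top_iff_one I).2 ((isDivisorial_iff.1 hI).2 1 fun y hy => ?_)
  rw [map_one, one_mul, ← hJ]
  exact idealInv_anti hJI hy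

theorem isDivisorial_span_singleton [IsDomain R] [IsFractionRing R K] {b : R} (hb : b ≠ 0) :
    IsDivisorial K (Ideal.span {b}) := by
  have hb' : algebraMap R K b ≠ 0 :=
    (map_ne_zero_iff _ (IsFractionRing.injective R K)).2 hb
  refine isDivisorial_iff.2 ⟨by simpa using hb, fun a ha => ?_⟩
  obtain ⟨c, hc⟩ := Submodule.mem_one.1 <| ha (algebraMap R K b)⁻¹ <| mem_idealInv.2 fun r hr => by
    obtain ⟨d, rfl⟩ := Ideal.mem_span_singleton.1 hr
    exact Submodule.mem_one.2 ⟨d, by rw [map_mul, inv_mul_cancel_left₀ hb']⟩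
  refine Ideal.mem_span_singleton.2 ⟨c, IsFractionRing.injective R K ?_⟩
  rw [map_mul, hc]
  field_simp

theorem IsDivisorial.colon_singleton [IsFractionRing R K] {P J : Ideal R} (hP : IsDivisorial K P)
    {x : R} (hJ : ∀ y, y ∈ J ↔ x * y ∈ P) : IsDivisorial K J := by
  have hPJ : P ≤ J := fun y hy => (hJ y).2 (P.mul_mem_left x hy)
  refine isDivisorial_iff.2 ⟨fun h => hP.1 (le_bot_iff.1 (h ▸ hPJ)), fun z hz => ?_⟩
  refine (hJ z).2 ((isDivisorial_iff.1 hP).2 _ fun w hw => ?_)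
  have h : algebraMap R K x * w ∈ idealInv K J := mem_idealInv.2 fun a ha => by
    have := mem_idealInv.1 hw _ ((hJ a).1 ha)
    rwa [map_mul, ← mul_assoc, mul_comm w] at this
  have := hz _ h
  rwa [← mul_assoc, mul_comm (algebraMap R K z), ← map_mul] at this

/-- Nonzero principal ideals are divisorial, so their ascending chains stabilise. -/
theorem IsMori.wfDvdMonoid [IsDomain R] [IsFractionRing R K] (h : IsMori R K) :
    WfDvdMonoid R := by
  have acc : ∀ I : {I : Ideal R // IsDivisorial K I}, ∀ b : R, b ≠ 0 → I.1 = Ideal.span {b} →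
      Acc DvdNotUnit b := by
    intro I
    induction I using h.wf.induction with
    | _ I ih =>
      intro b hb hI
      refine Acc.intro b fun c hc => ?_
      refine ih ⟨_, isDivisorial_span_singleton hc.1⟩ ?_ c hc.1 rfl
      change I.1 < Ideal.span {c}
      rw [hI]
      exact Ideal.span_singleton_lt_span_singleton.2 hc
  have acc' : ∀ b : R, b ≠ 0 → Acc DvdNotUnit b := fun b hb =>
    acc ⟨_, isDivisorial_span_singleton hb⟩ b hb rfl
  -- This also covers `b = 0`: `DvdNotUnit c b` includes `c ≠ 0`.
  exact ⟨⟨fun b => Acc.intro b fun c hc => acc' c hc.1⟩⟩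

/-- A Mori domain that is not a field has a divisorial prime ideal. -/
theorem IsMori.exists_isPrime_isDivisorial [IsDomain R] [IsFractionRing R K] (h : IsMori R K)
    (hR : ¬ IsField R) : ∃ P : Ideal R, P.IsPrime ∧ IsDivisorial K P := by
  obtain ⟨a, ha0, ha⟩ := Ring.exists_not_isUnit_of_not_isField hR
  obtain ⟨P, hP, hmax⟩ := h.wf.has_min {I | I.1 ≠ ⊤}
    ⟨⟨_, isDivisorial_span_singleton ha0⟩, by simpa [Ideal.span_singleton_eq_top] using ha⟩
  refine ⟨P.1, ⟨hP, fun {x y} hxy => or_iff_not_imp_left.2 fun hx => ?_⟩, P.2⟩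
  -- For `x ∉ P` the colon ideal `(P : x)` is proper, divisorial and contains `P`, so it equals `P`
  -- by maximality.
  let J : Ideal R := Submodule.comap (LinearMap.mulLeft R x) P.1
  have hJ : ∀ y, y ∈ J ↔ x * y ∈ P.1 := fun y => Iff.rfl
  have hPJ : P.1 ≤ J := fun y hy => (hJ y).2 (P.1.mul_mem_left x hy)
  have hJtop : J ≠ ⊤ := fun h => hx (by simpa using (hJ 1).1 (h ▸ trivial))
  have hnlt := hmax ⟨J, P.2.colon_singleton hJ⟩ hJtop
  exact hPJ.not_lt_iff_eq.1 hnlt ▸ (hJ y).2 hxy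

theorem isTLinked_of_one_mem {T : Subalgebra R K}
    (h : ∀ J : Ideal R, J.FG → idealInv K J = 1 →
      (1 : K) ∈ toSub K J * Subalgebra.toSubmodule T) : IsTLinked T := by
  intro J hJ hJ1
  have hJT : toSub K J * Subalgebra.toSubmodule T ≤ Subalgebra.toSubmodule T := by
    refine Submodule.mul_le.2 fun b hb t ht => ?_
    obtain ⟨c, -, rfl⟩ := (IsLocalization.mem_coeSubmodule K J).1 hb
    exact T.mul_mem (T.algebraMap_mem c) ht
  exact le_antisymm (fun x hx => by simpa using hx 1 (h J hJ hJ1))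
    fun x hx y hy => T.mul_mem hx (hJT hy)

theorem exists_isStronglyDivisorial [IsFractionRing R K] {hR : ¬ IsField R}
    (hphi : Function.Surjective (phi (R := R) K hR)) {T : Subalgebra R K} (hT : IsTLinked T)
    (hT' : T ≠ ⊤) :
    ∃ I : Ideal R, IsStronglyDivisorial K I ∧ Subalgebra.toSubmodule T = idealInv K I := by
  obtain ⟨I, hI⟩ := hphi ⟨T, hT, hT'⟩
  exact ⟨I.1, I.2, congrArg (fun S => Subalgebra.toSubmodule S.1) hI.symm⟩

end Divisorial

/-! ### Localizations as `t`-linked overrings. -/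

section LocalizationAtPrime

variable {R : Type*} [CommRing R] [IsDomain R] (K : Type*) [Field K] [Algebra R K]
  [IsFractionRing R K]

/-- The localization `R_P` of a domain at a prime ideal `P`, inside the field of fractions. -/
noncomputable def localizationAt (P : Ideal R) [P.IsPrime] : Subalgebra R K :=
  Localization.subalgebra.ofField K P.primeCompl P.primeCompl_le_nonZeroDivisors

variable {K}

theorem mem_localizationAt {P : Ideal R} [P.IsPrime] {x : K} :
    x ∈ localizationAt K P ↔
      ∃ a s : R, ∃ _ : s ∈ P.primeCompl, x = algebraMap R K a * (algebraMap R K s)⁻¹ :=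
  Iff.rfl

theorem inv_mem_localizationAt {P : Ideal R} [P.IsPrime] {s : R} (hs : s ∉ P) :
    (algebraMap R K s)⁻¹ ∈ localizationAt K P :=
  mem_localizationAt.2 ⟨1, s, hs, by simp⟩

theorem localizationAt_ne_top {P : Ideal R} [P.IsPrime] (hP : P ≠ ⊥) :
    localizationAt K P ≠ ⊤ := by
  intro h
  have hinj := IsFractionRing.injective R K
  obtain ⟨p, hp, hp0⟩ := Submodule.exists_mem_ne_zero_of_ne_bot hP
  obtain ⟨a, s, hs, hx⟩ := mem_localizationAt.1
    (h ▸ Algebra.mem_top : (algebraMap R K p)⁻¹ ∈ localizationAt K P)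
  have hp' : algebraMap R K p ≠ 0 := (map_ne_zero_iff _ hinj).2 hp0
  have hs' : algebraMap R K s ≠ 0 :=
    (map_ne_zero_iff _ hinj).2 fun h0 => hs (h0 ▸ P.zero_mem)
  have hsp : s = a * p := hinj (by
    rw [map_mul]
    field_simp at hx
    linear_combination hx)
  exact hs (hsp ▸ P.mul_mem_left a hp)

theorem isTLinked_localizationAt {P : Ideal R} [P.IsPrime]
    (h : ∀ J : Ideal R, J.FG → idealInv K J = 1 → ¬ J ≤ P) : IsTLinked (localizationAt K P) := by
  refine isTLinked_of_one_mem fun J hJ hJ1 => ?_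
  obtain ⟨s, hsJ, hsP⟩ := SetLike.not_le_iff_exists.1 (h J hJ hJ1)
  have hs' : algebraMap R K s ≠ 0 :=
    (map_ne_zero_iff _ (IsFractionRing.injective R K)).2 fun h0 => hsP (h0 ▸ P.zero_mem)
  rw [← mul_inv_cancel₀ hs']
  exact Submodule.mul_mem_mul (algebraMap_mem_toSub.2 hsJ) (inv_mem_localizationAt hsP)

theorem isUnit_of_notMem {hR : ¬ IsField R} (hphi : Function.Surjective (phi (R := R) K hR))
    [WfDvdMonoid R] {P : Ideal R} [P.IsPrime] (hP : P ≠ ⊥)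
    (h : ∀ J : Ideal R, J.FG → idealInv K J = 1 → ¬ J ≤ P) {s : R} (hs : s ∉ P) : IsUnit s := by
  have hinj := IsFractionRing.injective R K
  obtain ⟨I, hI, hPI⟩ := exists_isStronglyDivisorial hphi (isTLinked_localizationAt h)
    (localizationAt_ne_top hP)
  obtain ⟨a, ha, ha0⟩ := Submodule.exists_mem_ne_zero_of_ne_bot hI.1.1
  by_contra hsu
  -- Since `s⁻ⁿ ∈ R_P = I⁻¹`, each `a s⁻ⁿ` lies in `R`, so `s ^ n ∣ a` for every `n`.
  refine FiniteMultiplicity.not_iff_forall.2 (fun n => ?_)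
    (FiniteMultiplicity.of_not_isUnit hsu ha0)
  have hsn : s ^ n ∉ P := fun h' => hs (Ideal.IsPrime.mem_of_pow_mem ‹_› n h')
  have hs' : algebraMap R K (s ^ n) ≠ 0 :=
    (map_ne_zero_iff _ hinj).2 fun h0 => hsn (h0 ▸ P.zero_mem)
  have hinv : (algebraMap R K (s ^ n))⁻¹ ∈ idealInv K I := hPI ▸ inv_mem_localizationAt hsn
  obtain ⟨c, hc⟩ := Submodule.mem_one.1 (mem_idealInv.1 hinv a ha)
  refine ⟨c, hinj ?_⟩
  rw [map_mul, hc, mul_inv_cancel_left₀ hs']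

end LocalizationAtPrime

/-! ### The maximal ideal of a local ring. -/

section Local

variable {R : Type*} [CommRing R] [IsLocalRing R]

open IsLocalRing

theorem isDiscreteValuationRing_of_maximalIdeal_eq_span [IsDomain R] [WfDvdMonoid R] {m : R} (hm0 : m ≠ 0)
    (hm : maximalIdeal R = Ideal.span {m}) : IsDiscreteValuationRing R := by
  have hmu : ¬ IsUnit m := (mem_maximalIdeal m).1 (hm ▸ Ideal.mem_span_singleton_self m)
  have hprime : Prime m := (Ideal.span_singleton_prime hm0).1 (hm ▸ inferInstance)
  refine IsDiscreteValuationRing.ofHasUnitMulPowIrreducibleFactorization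
    ⟨m, hprime.irreducible, fun {x} hx => ?_⟩
  obtain ⟨c, hc, hmc⟩ :=
    (FiniteMultiplicity.of_not_isUnit hmu hx).exists_eq_pow_mul_and_not_dvd
  have hcu : IsUnit c := by
    by_contra hcu
    exact hmc (Ideal.mem_span_singleton.1 (hm ▸ (mem_maximalIdeal c).2 hcu))
  exact ⟨_, hcu.unit, hc.symm⟩

/-- The nonzero maximal ideal of a local domain is strong or principal. -/
theorem isStrong_maximalIdeal_or_eq_span (K : Type*) [Field K] [Algebra R K] [IsFractionRing R K]
    (hM : maximalIdeal R ≠ ⊥) :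
    IsStrong K (maximalIdeal R) ∨ ∃ m : R, m ≠ 0 ∧ maximalIdeal R = Ideal.span {m} := by
  have hinj := IsFractionRing.injective R K
  by_cases h : ∃ m ∈ maximalIdeal R, ∃ x ∈ idealInv K (maximalIdeal R),
      ∃ u : R, IsUnit u ∧ algebraMap R K m * x = algebraMap R K u
  · obtain ⟨m, hm, x, hx, _, ⟨u, rfl⟩, hu⟩ := h
    refine Or.inr ⟨m, ?_, le_antisymm (fun y hy => ?_) ?_⟩
    · rintro rfl
      rw [map_zero, zero_mul] at hu
      exact u.ne_zero (hinj (by rw [← hu, map_zero]))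
    · obtain ⟨c, hc⟩ := Submodule.mem_one.1 (mem_idealInv.1 hx y hy)
      have h1 : algebraMap R K (u : R) * algebraMap R K y =
          algebraMap R K (u : R) * algebraMap R K (m * (c * (↑u⁻¹ : R))) := by
        have h2 : (u : R) * (m * (c * (↑u⁻¹ : R))) = m * c := by
          linear_combination m * c * u.mul_inv
        rw [← map_mul _ (u : R) (m * _), h2, map_mul, hc, ← hu]
        ring
      have h3 := mul_left_cancel₀ ((map_ne_zero_iff _ hinj).2 u.ne_zero) h1
      exact Ideal.mem_span_singleton.2 ⟨_, hinj h3⟩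
    · exact (Ideal.span_singleton_le_iff_mem _).2 hm
  · push Not at h
    refine Or.inl ⟨hM, le_antisymm (Submodule.mul_le.2 fun y hy x hx => ?_) fun y hy => ?_⟩
    · obtain ⟨m, hm, rfl⟩ := (IsLocalization.mem_coeSubmodule K _).1 hy
      obtain ⟨c, hc⟩ := Submodule.mem_one.1 (mem_idealInv.1 hx m hm)
      have hcu : ¬ IsUnit c := fun hcu => h m hm x hx c hcu (by rw [mul_comm]; exact hc.symm)
      have hyx : algebraMap R K m * x = algebraMap R K c := by rw [mul_comm]; exact hc.symm
      exact (congrArg (· ∈ toSub K (maximalIdeal R)) hyx).mpr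
        (algebraMap_mem_toSub.2 ((mem_maximalIdeal c).2 hcu))
    · simpa using Submodule.mul_mem_mul hy (one_mem_idealInv (K := K) (maximalIdeal R))

end Local

end TLinked

theorem mainTheorem5 {R : Type*} [CommRing R] [IsDomain R] (K : Type*) [Field K] [Algebra R K]
    [IsFractionRing R K] (hR : ¬ IsField R) (hMori : TLinked.IsMori R K)
    (hphi : Function.Surjective (TLinked.phi (R := R) K hR)) :
    ringKrullDim R = 1 ∧ TLinked.IsConducive R K ∧
      ∃ _ : IsLocalRing R,
        IsDiscreteValuationRing R ∨
          (TLinked.IsStronglyDivisorial K (IsLocalRing.maximalIdeal R) ∧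
            ∀ T : Subalgebra R K, T ≠ ⊥ →
              TLinked.idealInv K (IsLocalRing.maximalIdeal R) ≤ Subalgebra.toSubmodule T) := by
  have := hMori.wfDvdMonoid
  obtain ⟨P, hPp, hPd⟩ := hMori.exists_isPrime_isDivisorial hR
  have hunit : ∀ s : R, s ∉ P → IsUnit s := fun s hs =>
    TLinked.isUnit_of_notMem hphi hPd.1
      (fun J _ hJ hJP => hPp.ne_top (hPd.eq_top_of_le hJP hJ)) hs
  have hmem : ∀ s : R, s ∈ P ↔ ¬ IsUnit s := fun s =>
    ⟨fun hs hu => hPp.ne_top (Ideal.eq_top_of_isUnit_mem P hs hu),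
      fun hu => by_contra fun hs => hu (hunit s hs)⟩
  have hloc : IsLocalRing R := IsLocalRing.of_nonunits_add fun a b ha hb =>
    (hmem _).1 (P.add_mem ((hmem a).2 ha) ((hmem b).2 hb))
  obtain rfl : P = IsLocalRing.maximalIdeal R :=
    Ideal.ext fun s => (hmem s).trans (IsLocalRing.mem_maximalIdeal s).symm
  have hfg : ∀ J : Ideal R, TLinked.idealInv K J = 1 → J = ⊤ := fun J hJ => by
    by_contra hJt
    exact hPp.ne_top (hPd.eq_top_of_le (IsLocalRing.le_maximalIdeal hJt) hJ)
  have htl : ∀ T : Subalgebra R K, TLinked.IsTLinked T := fun T =>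
    TLinked.isTLinked_of_one_mem fun J _ hJ => by
      have h1 : (1 : K) ∈ TLinked.toSub K J := by
        rw [hfg J hJ, ← map_one (algebraMap R K)]
        exact TLinked.algebraMap_mem_toSub.2 trivial
      simpa using Submodule.mul_mem_mul h1 (one_mem T)
  refine ⟨?_, fun T hT h0 => ?_, hloc, ?_⟩
  · refine ringKrullDim_eq_one_iff_of_isLocalRing_isDomain.2 ⟨hR, fun x hx => ?_⟩
    rw [Ideal.radical_eq_sInf]
    -- A prime `Q` containing `x ≠ 0` is nonzero, so every element outside it is a unit and `Q`
    -- contains `M`.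
    refine le_sInf fun Q ⟨hxQ, hQ⟩ s hs => by_contra fun hsQ => ?_
    refine (IsLocalRing.mem_maximalIdeal s).1 hs (TLinked.isUnit_of_notMem hphi (P := Q) ?_
      (fun J _ hJ hJQ => hQ.ne_top (top_le_iff.1 (hfg J hJ ▸ hJQ))) hsQ)
    rintro rfl
    exact hx (by simpa using hxQ)
  · obtain ⟨I, hI, hTI⟩ := TLinked.exists_isStronglyDivisorial hphi (htl T) hT
    rw [hTI, hI.2.2] at h0
    refine hI.2.1 ((Submodule.eq_bot_iff I).2 fun a ha => IsFractionRing.injective R K ?_)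
    rw [map_zero]
    exact (Submodule.mem_bot R).1 (h0 ▸ TLinked.algebraMap_mem_toSub.2 ha)
  · obtain hM | ⟨m, hm0, hm⟩ := TLinked.isStrong_maximalIdeal_or_eq_span K hPd.1
    · refine Or.inr ⟨⟨hM, hPd⟩, fun T hT => ?_⟩
      by_cases hT' : T = ⊤
      · exact fun x _ => (hT' ▸ Algebra.mem_top : x ∈ T)
      obtain ⟨I, hI, hTI⟩ := TLinked.exists_isStronglyDivisorial hphi (htl T) hT'
      rw [hTI]
      -- If `I` were `R`, then `T = I⁻¹ = R`, which is excluded.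
      refine TLinked.idealInv_anti (IsLocalRing.le_maximalIdeal fun hIt => hT ?_)
      rw [hIt, TLinked.idealInv_top, ← Algebra.toSubmodule_bot] at hTI
      exact Subalgebra.toSubmodule_injective hTI
    · exact Or.inl (TLinked.isDiscreteValuationRing_of_maximalIdeal_eq_span hm0 hm)
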